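/- Let $n\ge 3$ and $2\le k\le n-1$ be integers. For a symmetric linear operator $T$ with eigenvalues $\lambda(T)$ let $\sigma_j(\lambda(T))$ be the $j$-th elementary symmetric function of the eigenvalues. Let $D\subset\mathbb R^n$ be a bounded open set with smooth boundary $\Gamma=\partial D$ which is - star-shaped with respect to the origin: $0\in D$, $tx\in D$ for all $x\in D$ and $t\in[0,1]$, and $\langle x,\nu(x)\rangle>0$ for all $x\in\Gamma$, where $\nu$ is the outward unit normal; - strictly $(k-1)$-convex: at every point of $\Gamma$ the principal curvatures $\kappa=(\kappa_1,\dots,\kappa_{n-1})$ (with the sign for which spheres bounding balls have positive curvatures) satisfy $\sigma_j(\kappa)>0$ for $j=1,\dots,k-1$. Let $\rho(\theta)$, $\theta\in\mathbb S^{n-1}$, be the radial function of $D$, so that $\Gamma=\{\rho(\theta)\theta:\theta\in\mathbb S^{n-1}\}$, and put $\mathfrak b(x)=r/\rho(\theta)$ for $x=r\theta$, $r>0$, $\theta\in\mathbb S^{n-1}$. Let $\varphi\in C^\infty(\Gamma)$, extended to $\mathbb R^n\setminus\{0\}$ by $\varphi(r\theta):=\varphi(\rho(\theta)\theta)$. Let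 $A$ be a real symmetric positive definite $n\times n$ matrix with $\sigma_k(\lambda(A))=1$, and let $E_1=\{x\in\mathbb R^n:\tfrac12x^{T}Ax<1\}$. Then there exists a constant $N_1>0$ (depending on $n,k,D,\varphi,A$) such that for every real $N\ge N_1$ the function $$\underline\phi=\mathfrak b^N-1+\varphi$$ is strictly $k$-convex in $E_1\setminus\overline D$, that is, $\underline\phi\in C^2(E_1\setminus\overline D)$ and $\sigma_j(\lambda(D^2\underline\phi))>0$ in $E_1\setminus\overline D$ for $j=1,\dots,k$. Moreover, $\sigma_k(\lambda(D^2\underline\phi))>1$ in $E_1\setminus\overline D$, and $\underline\phi=\varphi$ on $\Gamma$. -/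

import Mathlib

open scoped ContDiff RealInnerProductSpace

noncomputable section

namespace ExteriorHessian

/-- The eigenvalues, repeated with multiplicity, of a linear operator on a finite dimensional
real vector space: the real roots of its characteristic polynomial. (It is only used for
self-adjoint operators, for which all the roots are real.) -/
def eigs {V : Type*} [AddCommGroup V] [Module ℝ V] [FiniteDimensional ℝ V]
    (T : V →ₗ[ℝ] V) : Multiset ℝ :=
  T.charpoly.roots

/-- `σ_k(λ(T))`, the `k`-th elementary symmetric function of the eigenvalues of `T`. -/
def sigma {V : Type*} [AddCommGroup V] [Module ℝ V] [FiniteDimensional ℝ V]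
    (k : ℕ) (T : V →ₗ[ℝ] V) : ℝ :=
  (eigs T).esymm k

/-- The Hessian `D²u(x)`, as the linear operator whose matrix in the standard basis is
`(∂ᵢ∂ⱼ u(x))`. -/
def hessian {n : ℕ} (u : EuclideanSpace ℝ (Fin n) → ℝ) (x : EuclideanSpace ℝ (Fin n)) :
    EuclideanSpace ℝ (Fin n) →ₗ[ℝ] EuclideanSpace ℝ (Fin n) :=
  (fderiv ℝ (gradient u) x).toLinearMap

/-- `u` is a strictly `k`-convex function on the open set `U`: it is `C²` there and
`σ_j(λ(D²u)) > 0` on `U` for `j = 1, …, k`. -/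
def StrictlyKConvexOn {n : ℕ} (k : ℕ) (u : EuclideanSpace ℝ (Fin n) → ℝ)
    (U : Set (EuclideanSpace ℝ (Fin n))) : Prop :=
  ContDiffOn ℝ 2 u U ∧ ∀ x ∈ U, ∀ j : ℕ, 1 ≤ j → j ≤ k → 0 < sigma j (hessian u x)

/-- `f` is a smooth defining function of `D` on the open neighbourhood `U` of the point `x`:
inside `U` the set `D` is `{f < 0}`, and the gradient of `f` does not vanish on `{f = 0}`.
Consequently `∂D ∩ U = {f = 0} ∩ U`, and `∇f / |∇f|` is the outward unit normal there. -/
structure IsLocalDefiningFunction {n : ℕ} (D : Set (EuclideanSpace ℝ (Fin n)))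
    (x : EuclideanSpace ℝ (Fin n)) (U : Set (EuclideanSpace ℝ (Fin n)))
    (f : EuclideanSpace ℝ (Fin n) → ℝ) : Prop where
  isOpen : IsOpen U
  mem : x ∈ U
  smooth : ContDiffOn ℝ ∞ f U
  mem_iff : ∀ y ∈ U, y ∈ D ↔ f y < 0
  gradient_ne_zero : ∀ y ∈ U, f y = 0 → gradient f y ≠ 0

/-- `D` is a bounded open set with smooth boundary. -/
structure IsSmoothBoundedOpen {n : ℕ} (D : Set (EuclideanSpace ℝ (Fin n))) : Prop where
  isOpen : IsOpen D
  isBounded : Bornology.IsBounded D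
  smooth_boundary : ∀ x ∈ frontier D, ∃ U f, IsLocalDefiningFunction D x U f

/-- `D` is star-shaped with respect to the origin, in the sense used for smooth hypersurfaces:
`D` is star-shaped about `0 ∈ D`, and the outward normal `ν` satisfies `⟨x, ν(x)⟩ > 0` at every
boundary point `x`, so that `∂D` is a smooth radial graph over the unit sphere. -/
structure IsStarShaped {n : ℕ} (D : Set (EuclideanSpace ℝ (Fin n))) : Prop where
  zero_mem : (0 : EuclideanSpace ℝ (Fin n)) ∈ D
  starConvex : StarConvex ℝ 0 D
  normal_pos : ∀ x ∈ frontier D, ∀ U f, IsLocalDefiningFunction D x U f → 0 < ⟪x, gradient f x⟫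

/-- The tangent space at `x` of the level set of `f` through `x`. -/
abbrev tangent {n : ℕ} (f : EuclideanSpace ℝ (Fin n) → ℝ) (x : EuclideanSpace ℝ (Fin n)) :
    Submodule ℝ (EuclideanSpace ℝ (Fin n)) :=
  (ℝ ∙ gradient f x)ᗮ

/-- The shape operator at `x` of the level set of `f` through `x`: the self-adjoint operator of the
tangent space which represents the second fundamental form `(v, w) ↦ D²f(x)(v, w) / |∇f(x)|`.
(This is the differential of the normal `∇f / |∇f|`; spheres bounding balls get positive
curvature.) -/
def shapeOperator {n : ℕ} (f : EuclideanSpace ℝ (Fin n) → ℝ) (x : EuclideanSpace ℝ (Fin n)) :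
    tangent f x →ₗ[ℝ] tangent f x :=
  ‖gradient f x‖⁻¹ •
    ((tangent f x).orthogonalProjectionOnto.toLinearMap ∘ₗ hessian f x ∘ₗ (tangent f x).subtype)

/-- The domain `D` is strictly `m`-convex: at every boundary point the vector `κ` of principal
curvatures of `∂D` satisfies `σ_j(κ) > 0` for `j = 1, …, m`. The principal curvatures are the
eigenvalues of the shape operator; they do not depend on the defining function. -/
def IsStrictlyConvexDomain {n : ℕ} (m : ℕ) (D : Set (EuclideanSpace ℝ (Fin n))) : Prop :=
  ∀ x ∈ frontier D, ∀ U f, IsLocalDefiningFunction D x U f →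
    ∀ j : ℕ, 1 ≤ j → j ≤ m → 0 < sigma j (shapeOperator f x)

/-- `φ` is a smooth function on the subset `S` of `ℝⁿ` (used for smooth hypersurfaces `S`): locally
it is the restriction of a smooth function. Only the values of `φ` on `S` matter. -/
def SmoothOnSubset {n : ℕ} (φ : EuclideanSpace ℝ (Fin n) → ℝ)
    (S : Set (EuclideanSpace ℝ (Fin n))) : Prop :=
  ∀ x ∈ S, ∃ (U : Set (EuclideanSpace ℝ (Fin n))) (g : EuclideanSpace ℝ (Fin n) → ℝ),
    IsOpen U ∧ x ∈ U ∧ ContDiffOn ℝ ∞ g U ∧ Set.EqOn g φ (U ∩ S)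

/-- `𝒜_k`: the real symmetric positive definite `n × n` matrices with `σ_k(λ(A)) = 1`. -/
def classA (n k : ℕ) : Set (Matrix (Fin n) (Fin n) ℝ) :=
  {A | A.PosDef ∧ sigma k (Matrix.toLin' A) = 1}

/-- The ellipsoid `E_l = {x : ½ xᵀ A x < l}`. -/
def ellipsoid {n : ℕ} (A : Matrix (Fin n) (Fin n) ℝ) (l : ℝ) : Set (EuclideanSpace ℝ (Fin n)) :=
  {x | 1 / 2 * ∑ i, ∑ j, A i j * x i * x j < l}

/-- The radial function `ρ` of a domain that is star-shaped about `0`: in the direction of the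
unit vector `θ` the domain reaches up to `ρ(θ) θ`. -/
def radial {n : ℕ} (D : Set (EuclideanSpace ℝ (Fin n))) (θ : EuclideanSpace ℝ (Fin n)) : ℝ :=
  sSup {t : ℝ | 0 ≤ t ∧ t • θ ∈ D}

/-- The direction `θ = x / |x|` of a point `x ≠ 0`. -/
def direction {n : ℕ} (x : EuclideanSpace ℝ (Fin n)) : EuclideanSpace ℝ (Fin n) :=
  ‖x‖⁻¹ • x

/-- The function `𝔟 = r / ρ(θ)`. -/
def frakB {n : ℕ} (D : Set (EuclideanSpace ℝ (Fin n))) (x : EuclideanSpace ℝ (Fin n)) : ℝ :=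
  ‖x‖ / radial D (direction x)

/-- The extension of a function on `∂D` to `ℝⁿ ∖ {0}` that is constant along rays from the
origin. -/
def radialExtension {n : ℕ} (D : Set (EuclideanSpace ℝ (Fin n)))
    (φ : EuclideanSpace ℝ (Fin n) → ℝ) (x : EuclideanSpace ℝ (Fin n)) : ℝ :=
  φ (radial D (direction x) • direction x)

/-- The function `𝔟 ^ N - 1 + φ`, where `φ` is extended as a constant along rays. -/
def subsolution {n : ℕ} (D : Set (EuclideanSpace ℝ (Fin n)))
    (φ : EuclideanSpace ℝ (Fin n) → ℝ) (N : ℝ) (x : EuclideanSpace ℝ (Fin n)) : ℝ :=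
  frakB D x ^ N - 1 + radialExtension D φ x

end ExteriorHessian

end

/-!
The function `𝔟` is smooth away from the origin and homogeneous of degree one, `φ` is homogeneous of
degree zero, and every point outside `D` is `c • y` with `y ∈ ∂D` and `c = 𝔟(c • y) ≥ 1`. Hence, with
`p = ∇𝔟(y)`,

`D²(𝔟 ^ N - 1 + φ)(c • y) = N c ^ (N - 2) (D²𝔟(y) + ε D²φ(y) + (N - 1) p ⊗ p)`, `ε = 1 / (N c ^ N)`

(`hessian_subsolution_smul`), where `N c ^ (N - 2) ≥ 1` and `0 < ε ≤ 1 / N`. The elementary symmetric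
functions depend affinely on a rank-one perturbation:

`σ_(i+1)(B + t p ⊗ p) = σ_(i+1)(B) + t |p|² σ_i(B restricted to the orthogonal complement of p)`

(`charSigma_add_rankOne`). For `B = D²𝔟(y)` the restricted operator is `|p|` times the shape operator
of `∂D` at `y`, because `𝔟 - 1` is a defining function of `D`
(`isLocalDefiningFunction_frakB_sub_one`); so strict `(k - 1)`-convexity makes the slope in `t`
positive for `i ≤ k - 1`. By compactness of `∂D` the slope stays bounded below for small `ε`, and all
`σ_j` with `1 ≤ j ≤ k` exceed `1` when `N` is large (`eventually_forall_one_lt_charSigma`). The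
argument takes place on all of the complement of the closure of `D`.

Smoothness of `𝔟` comes from the implicit function theorem (`contDiffAt_frakB`): transversality
`⟨y, ν(y)⟩ > 0` shows both that a ray meets `∂D` exactly once and that the equation for the
intersection point is nondegenerate.
-/

namespace ExteriorHessian

/-! ### Elementary symmetric functions as coefficients of the characteristic polynomial -/

section LinearAlgebra

open Module Polynomial

variable {V : Type*} [NormedAddCommGroup V] [InnerProductSpace ℝ V] [FiniteDimensional ℝ V]

/-- The signed coefficient `(-1)^j [X^(d-j)] det (X - T)`, where `d = dim V`. Unlike `sigma`, it is
manifestly a homogeneous polynomial in `T`; the two agree if `T` is symmetric and `j ≤ d`. -/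
noncomputable def charSigma (j : ℕ) (T : V →ₗ[ℝ] V) : ℝ :=
  (-1) ^ j * T.charpoly.coeff (finrank ℝ V - j)

theorem sigma_eq_charSigma {j : ℕ} (hj : j ≤ finrank ℝ V) {T : V →ₗ[ℝ] V} (hT : T.IsSymmetric) :
    sigma j T = charSigma j T := by
  have h := coeff_eq_esymm_roots_of_card (splits_iff_card_roots.mp hT.splits_charpoly)
    (k := finrank ℝ V - j) (by rw [LinearMap.charpoly_natDegree]; omega)
  rw [LinearMap.charpoly_natDegree, (LinearMap.charpoly_monic T).leadingCoeff,
    Nat.sub_sub_self hj, one_mul] at h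
  rw [sigma, eigs, charSigma, h, ← mul_assoc, ← mul_pow]
  simp

theorem charSigma_zero (T : V →ₗ[ℝ] V) : charSigma 0 T = 1 := by
  have h := (LinearMap.charpoly_monic T).coeff_natDegree
  rw [LinearMap.charpoly_natDegree] at h
  simp [charSigma, h]

theorem charSigma_smul {j : ℕ} (hj : j ≤ finrank ℝ V) (c : ℝ) (T : V →ₗ[ℝ] V) :
    charSigma j (c • T) = c ^ j * charSigma j T := by
  let φ : (V →ₗ[ℝ] V) →ₗ[ℝ] Module.End ℝ V := LinearMap.id
  let b := Module.finBasis ℝ (V →ₗ[ℝ] V)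
  have e : ∀ S : V →ₗ[ℝ] V, S.charpoly.coeff (finrank ℝ V - j) =
      MvPolynomial.eval (b.repr S) ((LinearMap.polyCharpoly φ b).coeff (finrank ℝ V - j)) :=
    fun S => (LinearMap.polyCharpoly_coeff_eval φ b S _).symm
  have hom := LinearMap.polyCharpoly_coeff_isHomogeneous φ b (finrank ℝ V - j) j (by omega)
  rw [charSigma, charSigma, e, e, map_smul, Finsupp.coe_smul, MvPolynomial.eval_eq',
    MvPolynomial.eval_eq', mul_left_comm]
  congr 1
  rw [Finset.mul_sum]
  refine Finset.sum_congr rfl fun d hd => ?_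
  have hdeg : Finsupp.weight 1 d = j := hom (MvPolynomial.mem_support_iff.mp hd)
  rw [Finsupp.weight_apply, d.sum_fintype _ fun _ => by simp] at hdeg
  simp only [Pi.one_apply, smul_eq_mul, mul_one] at hdeg
  simp only [Pi.smul_apply, smul_eq_mul, mul_pow, Finset.prod_mul_distrib,
    Finset.prod_pow_eq_pow_sum,
    hdeg]
  ring

theorem continuous_charSigma (j : ℕ) :
    Continuous fun T : V →L[ℝ] V => charSigma j T.toLinearMap := by
  let φ : (V →ₗ[ℝ] V) →ₗ[ℝ] Module.End ℝ V := LinearMap.id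
  let b := Module.finBasis ℝ (V →ₗ[ℝ] V)
  have e : ∀ S : V →ₗ[ℝ] V, S.charpoly.coeff (finrank ℝ V - j) =
      MvPolynomial.eval (b.repr S) ((LinearMap.polyCharpoly φ b).coeff (finrank ℝ V - j)) :=
    fun S => (LinearMap.polyCharpoly_coeff_eval φ b S _).symm
  simp only [charSigma, e]
  refine continuous_const.mul ((MvPolynomial.continuous_eval _).comp (continuous_pi fun i => ?_))
  exact (b.coord i ∘ₗ ContinuousLinearMap.coeLM ℝ).continuous_of_finiteDimensional

/-- The compression of `T` to the orthogonal complement of `p`. -/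
noncomputable def compression (p : V) (T : V →ₗ[ℝ] V) : (ℝ ∙ p)ᗮ →ₗ[ℝ] (ℝ ∙ p)ᗮ :=
  (ℝ ∙ p)ᗮ.orthogonalProjectionOnto.toLinearMap ∘ₗ T ∘ₗ (ℝ ∙ p)ᗮ.subtype

omit [FiniteDimensional ℝ V] in
theorem compression_isSymmetric (p : V) {T : V →ₗ[ℝ] V} (hT : T.IsSymmetric) :
    (compression p T).IsSymmetric := by
  intro v w
  simp [compression, hT (v : V) w]

theorem det_updateRow_zero_add_single {m : ℕ} {R : Type*} [CommRing R]
    (M : Matrix (Fin (m + 1)) (Fin (m + 1)) R) (s : R) :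
    (M.updateRow 0 (M 0 + s • Pi.single 0 1)).det =
      M.det + s * (M.submatrix Fin.succ Fin.succ).det := by
  rw [Matrix.det_updateRow_add, Matrix.det_updateRow_smul, Matrix.updateRow_eq_self,
    ← Matrix.adjugate_apply, Matrix.adjugate_fin_succ_eq_det_submatrix]
  simp

theorem charpoly_updateRow_zero_add_single {m : ℕ} (M : Matrix (Fin (m + 1)) (Fin (m + 1)) ℝ)
    (s : ℝ) :
    (M.updateRow 0 (M 0 + s • Pi.single 0 1)).charpoly =
      M.charpoly - C s * (M.submatrix Fin.succ Fin.succ).charpoly := by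
  have hchar : (M.updateRow 0 (M 0 + s • Pi.single 0 1)).charmatrix =
      M.charmatrix.updateRow 0 (M.charmatrix 0 + (-C s) • Pi.single 0 1) := by
    ext1 i k
    refine Fin.cases ?_ (fun i => ?_) i <;> refine Fin.cases ?_ (fun k => ?_) k <;>
      simp [Matrix.charmatrix_apply, Matrix.diagonal_apply, sub_eq_add_neg, add_comm,
        add_left_comm, Fin.succ_ne_zero]
  have hsub : M.charmatrix.submatrix Fin.succ Fin.succ =
      (M.submatrix Fin.succ Fin.succ).charmatrix := by
    ext1 i k
    simp [Matrix.charmatrix_apply, Matrix.diagonal_apply, Fin.succ_inj]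
  rw [Matrix.charpoly, hchar, det_updateRow_zero_add_single, hsub, Matrix.charpoly,
    Matrix.charpoly]
  ring

/-- In a basis consisting of `p` and a basis of `pᗮ`, the rank-one term only changes the `(p, p)`
entry of the matrix of `T`, and the complementary minor belongs to the compression. -/
theorem charpoly_add_rankOne {p : V} (hp : p ≠ 0) (T : V →ₗ[ℝ] V) (t : ℝ) :
    (T + t • (InnerProductSpace.rankOne ℝ p p).toLinearMap).charpoly =
      T.charpoly - C (t * ‖p‖ ^ 2) * (compression p T).charpoly := by
  let v := Module.finBasis ℝ (ℝ ∙ p)ᗮ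
  have horth : ∀ w : (ℝ ∙ p)ᗮ, ⟪p, (w : V)⟫ = 0 := fun w =>
    Submodule.mem_orthogonal_singleton_iff_inner_right.mp w.2
  let e : Basis (Fin (finrank ℝ (ℝ ∙ p)ᗮ + 1)) ℝ V := Basis.mkFinCons p v
    (fun c w hw h => by
      have := congrArg (fun z => ⟪p, z⟫) h
      simp [inner_add_right, inner_smul_right, horth ⟨w, hw⟩, hp] at this
      exact this)
    (fun z => ⟨-(⟪p, z⟫ / ‖p‖ ^ 2), by
      rw [Submodule.mem_orthogonal_singleton_iff_inner_right, inner_add_right, inner_smul_right,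
        real_inner_self_eq_norm_sq]
      have : ‖p‖ ≠ 0 := norm_ne_zero_iff.mpr hp
      field_simp
      ring⟩)
  have he0 : e 0 = p := by simp [e]
  have hp0 : e.repr p = Finsupp.single 0 1 := by
    have := e.repr_self 0
    rwa [he0] at this
  have hes : ∀ i, e (Fin.succ i) = v i := fun i => by simp [e]
  -- The basis `e` is adapted to the decomposition `V = ℝ p ⊕ pᗮ`.
  have hcoord : ∀ (i) (z : V),
      e.repr z (Fin.succ i) = v.repr ((ℝ ∙ p)ᗮ.orthogonalProjectionOnto z) i := by
    intro i
    have : e.coord (Fin.succ i) =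
        v.coord i ∘ₗ (ℝ ∙ p)ᗮ.orthogonalProjectionOnto.toLinearMap := by
      refine e.ext fun k => ?_
      refine Fin.cases ?_ (fun k => ?_) k
      · have h0 : (ℝ ∙ p)ᗮ.orthogonalProjectionOnto p = 0 :=
          Submodule.orthogonalProjectionOnto_orthogonal_apply_eq_zero
            (Submodule.mem_span_singleton_self p)
        simp [he0, h0, hp0]
      · have h1 : e.repr (v k : V) = Finsupp.single k.succ 1 := by rw [← hes, e.repr_self]
        simp [hes, h1, Finsupp.single_apply, Fin.succ_inj]
    exact fun z => LinearMap.congr_fun this z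
  have hcompr : (LinearMap.toMatrix e e T).submatrix Fin.succ Fin.succ =
      LinearMap.toMatrix v v (compression p T) := by
    ext i k
    simp [LinearMap.toMatrix_apply, hcoord, hes, compression]
  have hadd : LinearMap.toMatrix e e (T + t • (InnerProductSpace.rankOne ℝ p p).toLinearMap) =
      (LinearMap.toMatrix e e T).updateRow 0
        (LinearMap.toMatrix e e T 0 + (t * ‖p‖ ^ 2) • Pi.single 0 1) := by
    ext i k
    refine Fin.cases ?_ (fun i => ?_) i <;> refine Fin.cases ?_ (fun k => ?_) k <;>
      simp [LinearMap.toMatrix_apply, he0, hes, hp0, horth, Fin.succ_ne_zero]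
  rw [← LinearMap.charpoly_toMatrix _ e, ← LinearMap.charpoly_toMatrix T e,
    ← LinearMap.charpoly_toMatrix (compression p T) v, hadd, charpoly_updateRow_zero_add_single,
    hcompr]

theorem finrank_orthogonal_singleton_add_one {p : V} (hp : p ≠ 0) :
    finrank ℝ (ℝ ∙ p)ᗮ + 1 = finrank ℝ V := by
  have := (ℝ ∙ p).finrank_add_finrank_orthogonal
  rw [finrank_span_singleton hp] at this
  omega

/-- Rank-one perturbations act affinely on the elementary symmetric functions. -/
theorem charSigma_add_rankOne {p : V} (hp : p ≠ 0) {j : ℕ} (hj : j + 1 ≤ finrank ℝ V)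
    (T : V →ₗ[ℝ] V) (t : ℝ) :
    charSigma (j + 1) (T + t • (InnerProductSpace.rankOne ℝ p p).toLinearMap) =
      charSigma (j + 1) T + t * (‖p‖ ^ 2 * charSigma j (compression p T)) := by
  have hdim := finrank_orthogonal_singleton_add_one hp
  rw [charSigma, charSigma, charSigma, charpoly_add_rankOne hp, coeff_sub, coeff_C_mul,
    show finrank ℝ (ℝ ∙ p)ᗮ - j = finrank ℝ V - (j + 1) by omega]
  ring

end LinearAlgebra

/-! ### The radial structure of a star-shaped domain -/

section Radial

open Filter Topology

variable {n : ℕ} {D : Set (EuclideanSpace ℝ (Fin n))}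

theorem _root_.HasDerivAt.eventually_lt_nhdsLT {g : ℝ → ℝ} {g' a : ℝ} (h : HasDerivAt g g' a)
    (hg : 0 < g') : ∀ᶠ t in 𝓝[<] a, g t < g a := by
  have h1 := (hasDerivAt_iff_tendsto_slope.mp h).eventually_const_lt hg
  filter_upwards [h1.filter_mono (nhdsLT_le_nhdsNE a), self_mem_nhdsWithin] with t ht (hta : t < a)
  rw [slope_def_field] at ht
  rcases div_pos_iff.mp ht with h2 | h2 <;> linarith [h2.1, h2.2]

namespace IsLocalDefiningFunction

variable {x y : EuclideanSpace ℝ (Fin n)} {U : Set (EuclideanSpace ℝ (Fin n))}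
  {f : EuclideanSpace ℝ (Fin n) → ℝ}

theorem contDiffAt (h : IsLocalDefiningFunction D x U f) (hy : y ∈ U) : ContDiffAt ℝ ∞ f y :=
  h.smooth.contDiffAt (h.isOpen.mem_nhds hy)

theorem differentiableAt (h : IsLocalDefiningFunction D x U f) (hy : y ∈ U) :
    DifferentiableAt ℝ f y :=
  (h.contDiffAt hy).differentiableAt (by simp)

theorem eq_zero_of_mem_frontier (h : IsLocalDefiningFunction D x U f) (hD : IsOpen D) (hy : y ∈ U)
    (hyD : y ∈ frontier D) : f y = 0 := by
  rw [hD.frontier_eq] at hyD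
  refine le_antisymm ?_ (not_lt.mp fun h0 => hyD.2 ((h.mem_iff y hy).mpr h0))
  by_contra! h0
  have h1 : ∀ᶠ z in 𝓝 y, 0 < f z ∧ z ∈ U :=
    ((h.differentiableAt hy).continuousAt.eventually_const_lt h0).and (h.isOpen.mem_nhds hy)
  obtain ⟨z, hz, hzD⟩ := mem_closure_iff_nhds.mp hyD.1 _ h1
  exact lt_asymm hz.1 ((h.mem_iff z hz.2).mp hzD)

/-- Along a direction in which `f` increases, `f` is negative just before a zero. -/
theorem eventually_mem (h : IsLocalDefiningFunction D x U f) (hy : y ∈ U) (hfy : f y = 0)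
    {v : EuclideanSpace ℝ (Fin n)} (hv : 0 < ⟪v, gradient f y⟫) :
    ∀ᶠ t in 𝓝[<] (0 : ℝ), y + t • v ∈ D := by
  have hline : HasDerivAt (fun t : ℝ => y + t • v) v 0 := by
    simpa using ((hasDerivAt_id (0 : ℝ)).smul_const v).const_add y
  have hd : HasDerivAt (fun t : ℝ => f (y + t • v)) (fderiv ℝ f y v) 0 := by
    have hf : HasFDerivAt f (fderiv ℝ f y) (y + (0 : ℝ) • v) := by
      simpa using (h.differentiableAt hy).hasFDerivAt
    exact hf.comp_hasDerivAt 0 hline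
  have hU : ∀ᶠ t in 𝓝 (0 : ℝ), y + t • v ∈ U :=
    hline.continuousAt.eventually (by simpa using h.isOpen.mem_nhds hy)
  rw [inner_gradient_right] at hv
  filter_upwards [hd.eventually_lt_nhdsLT hv, hU.filter_mono nhdsWithin_le_nhds] with t ht htU
  exact (h.mem_iff _ htU).mpr (by simpa [hfy] using ht)

theorem mem_frontier_of_eq_zero (h : IsLocalDefiningFunction D x U f) (hD : IsOpen D) (hy : y ∈ U)
    (hfy : f y = 0) : y ∈ frontier D := by
  rw [hD.frontier_eq]
  refine ⟨?_, fun hyD => ((h.mem_iff y hy).mp hyD).ne hfy⟩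
  have hv : 0 < ⟪gradient f y, gradient f y⟫ :=
    real_inner_self_pos.mpr (h.gradient_ne_zero y hy hfy)
  have hlim : Tendsto (fun t : ℝ => y + t • gradient f y) (𝓝[<] 0) (𝓝 y) := by
    have : Continuous fun t : ℝ => y + t • gradient f y := by fun_prop
    simpa using (this.tendsto 0).mono_left nhdsWithin_le_nhds
  exact mem_closure_of_tendsto hlim (h.eventually_mem hy hfy hv)

end IsLocalDefiningFunction

theorem ne_zero_of_mem_frontier (hD : IsSmoothBoundedOpen D) (hstar : IsStarShaped D)
    {y : EuclideanSpace ℝ (Fin n)} (hy : y ∈ frontier D) : y ≠ 0 := by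
  rintro rfl
  rw [hD.isOpen.frontier_eq] at hy
  exact hy.2 hstar.zero_mem

theorem smul_mem_of_mem (hstar : IsStarShaped D) {y : EuclideanSpace ℝ (Fin n)} (hy : y ∈ D)
    {t : ℝ} (h0 : 0 ≤ t) (h1 : t ≤ 1) : t • y ∈ D := by
  simpa using hstar.starConvex.smul_mem (by simpa using hy) h0 h1

/-- The transversality `⟨y, ν(y)⟩ > 0` makes the ray through a boundary point `y` leave `D`
exactly at `y`. -/
theorem smul_mem_iff_of_mem_frontier (hD : IsSmoothBoundedOpen D) (hstar : IsStarShaped D)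
    {y : EuclideanSpace ℝ (Fin n)} (hy : y ∈ frontier D) {t : ℝ} (h0 : 0 ≤ t) :
    t • y ∈ D ↔ t < 1 := by
  constructor
  · intro h
    by_contra! h1
    rw [hD.isOpen.frontier_eq] at hy
    refine hy.2 ?_
    have := smul_mem_of_mem hstar h (inv_nonneg.mpr h0) (inv_le_one_of_one_le₀ h1)
    rwa [smul_smul, inv_mul_cancel₀ (by positivity), one_smul] at this
  · intro h
    obtain ⟨U, f, hf⟩ := hD.smooth_boundary y hy
    have hev := hf.eventually_mem hf.mem (hf.eq_zero_of_mem_frontier hD.isOpen hf.mem hy)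
      (hstar.normal_pos y hy U f hf)
    obtain ⟨s, hs, hs1, hs0⟩ :=
      (hev.and (Ioo_mem_nhdsLT (show t - 1 < 0 by linarith))).exists
    have hs' : (1 + s) • y ∈ D := by simpa [add_smul] using hs
    have hpos : 0 < 1 + s := by linarith
    have := smul_mem_of_mem hstar hs' (t := t / (1 + s)) (by positivity)
      ((div_le_one hpos).mpr (by linarith))
    rwa [smul_smul, div_mul_cancel₀ _ hpos.ne'] at this

theorem radial_smul_direction (hD : IsSmoothBoundedOpen D) (hstar : IsStarShaped D)
    {y : EuclideanSpace ℝ (Fin n)} (hy : y ∈ frontier D) {c : ℝ} (hc : 0 < c) :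
    direction (c • y) = ‖y‖⁻¹ • y ∧ radial D (direction (c • y)) = ‖y‖ := by
  have hy0 : 0 < ‖y‖ := norm_pos_iff.mpr (ne_zero_of_mem_frontier hD hstar hy)
  have hdir : direction (c • y) = ‖y‖⁻¹ • y := by
    rw [direction, norm_smul, Real.norm_of_nonneg hc.le, smul_smul]
    congr 1
    field_simp
  refine ⟨hdir, ?_⟩
  have hset : {t : ℝ | 0 ≤ t ∧ t • direction (c • y) ∈ D} = Set.Ico 0 ‖y‖ := by
    ext t
    simp only [Set.mem_ofPred_eq, Set.mem_Ico]
    refine and_congr_right fun ht => ?_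
    rw [hdir, smul_smul, ← div_eq_mul_inv,
      smul_mem_iff_of_mem_frontier hD hstar hy (by positivity), div_lt_one hy0]
  rw [radial, hset, csSup_Ico hy0]

theorem frakB_smul_of_mem_frontier (hD : IsSmoothBoundedOpen D) (hstar : IsStarShaped D)
    {y : EuclideanSpace ℝ (Fin n)} (hy : y ∈ frontier D) {c : ℝ} (hc : 0 < c) :
    frakB D (c • y) = c := by
  have hy0 : 0 < ‖y‖ := norm_pos_iff.mpr (ne_zero_of_mem_frontier hD hstar hy)
  rw [frakB, (radial_smul_direction hD hstar hy hc).2, norm_smul, Real.norm_of_nonneg hc.le]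
  field_simp

theorem radialExtension_smul_of_mem_frontier (hD : IsSmoothBoundedOpen D) (hstar : IsStarShaped D)
    (φ : EuclideanSpace ℝ (Fin n) → ℝ) {y : EuclideanSpace ℝ (Fin n)} (hy : y ∈ frontier D)
    {c : ℝ} (hc : 0 < c) : radialExtension D φ (c • y) = φ y := by
  have hy0 : 0 < ‖y‖ := norm_pos_iff.mpr (ne_zero_of_mem_frontier hD hstar hy)
  obtain ⟨h1, h2⟩ := radial_smul_direction hD hstar hy hc
  rw [radialExtension, h2, h1, smul_smul, mul_inv_cancel₀ hy0.ne', one_smul]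

theorem exists_smul_mem_frontier (hD : IsSmoothBoundedOpen D) (hstar : IsStarShaped D)
    {x : EuclideanSpace ℝ (Fin n)} (hx : x ≠ 0) :
    ∃ c : ℝ, 0 < c ∧ ∃ y ∈ frontier D, x = c • y := by
  obtain ⟨R, hR⟩ := hD.isBounded.closure.exists_norm_le
  have hray : IsPreconnected ((fun t : ℝ => t • x) '' Set.Ici 0) :=
    isPreconnected_Ici.image _ (by fun_prop)
  have hx0 : 0 < ‖x‖ := norm_pos_iff.mpr hx
  obtain ⟨_, ⟨t, ht, rfl⟩, htf⟩ : (((fun t : ℝ => t • x) '' Set.Ici 0) ∩ frontier D).Nonempty := by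
    by_contra hne
    have hcover : (fun t : ℝ => t • x) '' Set.Ici 0 ⊆ D ∪ (closure D)ᶜ := fun z hz => by
      by_contra hzD
      rw [Set.mem_union, not_or, Set.notMem_compl_iff] at hzD
      exact hne ⟨z, hz, by rw [hD.isOpen.frontier_eq]; exact ⟨hzD.2, hzD.1⟩⟩
    have hR0 : 0 ≤ R := by simpa using hR 0 (subset_closure hstar.zero_mem)
    have hfar : ((R + 1) / ‖x‖) • x ∉ closure D := fun hmem => by
      have := hR _ hmem
      rw [norm_smul, Real.norm_of_nonneg (by positivity), div_mul_cancel₀ _ hx0.ne'] at this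
      linarith
    obtain ⟨z, -, hz, hz'⟩ := hray D (closure D)ᶜ hD.isOpen isClosed_closure.isOpen_compl hcover
      ⟨0, ⟨0, by simp, by simp⟩, hstar.zero_mem⟩
      ⟨_, ⟨(R + 1) / ‖x‖, by simp only [Set.mem_Ici]; positivity, rfl⟩, hfar⟩
    exact hz' (subset_closure hz)
  have htx : t • x ≠ 0 := ne_zero_of_mem_frontier hD hstar htf
  have ht0 : t ≠ 0 := (smul_ne_zero_iff.mp htx).1
  have ht : 0 < t := lt_of_le_of_ne ht ht0.symm
  exact ⟨t⁻¹, inv_pos.mpr ht, _, htf, by rw [smul_smul, inv_mul_cancel₀ ht0, one_smul]⟩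

theorem frakB_pos (hD : IsSmoothBoundedOpen D) (hstar : IsStarShaped D)
    {x : EuclideanSpace ℝ (Fin n)} (hx : x ≠ 0) : 0 < frakB D x := by
  obtain ⟨c, hc, y, hy, rfl⟩ := exists_smul_mem_frontier hD hstar hx
  rwa [frakB_smul_of_mem_frontier hD hstar hy hc]

theorem frakB_smul (hD : IsSmoothBoundedOpen D) (hstar : IsStarShaped D)
    {x : EuclideanSpace ℝ (Fin n)} (hx : x ≠ 0) {t : ℝ} (ht : 0 < t) :
    frakB D (t • x) = t * frakB D x := by
  obtain ⟨c, hc, y, hy, rfl⟩ := exists_smul_mem_frontier hD hstar hx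
  rw [smul_smul, frakB_smul_of_mem_frontier hD hstar hy hc,
    frakB_smul_of_mem_frontier hD hstar hy (mul_pos ht hc)]

theorem radialExtension_smul (hD : IsSmoothBoundedOpen D) (hstar : IsStarShaped D)
    (φ : EuclideanSpace ℝ (Fin n) → ℝ) {x : EuclideanSpace ℝ (Fin n)} (hx : x ≠ 0) {t : ℝ}
    (ht : 0 < t) : radialExtension D φ (t • x) = radialExtension D φ x := by
  obtain ⟨c, hc, y, hy, rfl⟩ := exists_smul_mem_frontier hD hstar hx
  rw [smul_smul, radialExtension_smul_of_mem_frontier hD hstar φ hy hc,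
    radialExtension_smul_of_mem_frontier hD hstar φ hy (mul_pos ht hc)]

theorem mem_iff_frakB_lt_one (hD : IsSmoothBoundedOpen D) (hstar : IsStarShaped D)
    {x : EuclideanSpace ℝ (Fin n)} (hx : x ≠ 0) : x ∈ D ↔ frakB D x < 1 := by
  obtain ⟨c, hc, y, hy, rfl⟩ := exists_smul_mem_frontier hD hstar hx
  rw [frakB_smul_of_mem_frontier hD hstar hy hc,
    smul_mem_iff_of_mem_frontier hD hstar hy hc.le]

theorem _root_.ContinuousLinearMap.isInvertible_of_apply_one_ne_zero {L : ℝ →L[ℝ] ℝ}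
    (h : L 1 ≠ 0) : L.IsInvertible :=
  ⟨ContinuousLinearEquiv.unitsEquivAut ℝ (Units.mk0 _ h), by ext; simp⟩

/-- Near `x = c • y` with `y ∈ ∂D`, the function `1 / 𝔟` is the solution `s` of `f (s • x) = 0`,
where `f` is a defining function near `y`; `⟨y, ∇f(y)⟩ > 0` is what the implicit function theorem
needs. -/
theorem contDiffAt_frakB (hD : IsSmoothBoundedOpen D) (hstar : IsStarShaped D)
    {x : EuclideanSpace ℝ (Fin n)} (hx : x ≠ 0) : ContDiffAt ℝ ∞ (frakB D) x := by
  obtain ⟨c, hc, y, hy, rfl⟩ := exists_smul_mem_frontier hD hstar hx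
  obtain ⟨U, f, hf⟩ := hD.smooth_boundary y hy
  have hfy := hf.eq_zero_of_mem_frontier hD.isOpen hf.mem hy
  set x := c • y with hxdef
  have hcx : c⁻¹ • x = y := by rw [hxdef, smul_smul, inv_mul_cancel₀ hc.ne', one_smul]
  let F : EuclideanSpace ℝ (Fin n) × ℝ → ℝ := fun q => f (q.2 • q.1)
  have hsm : ContDiff ℝ ∞ fun q : EuclideanSpace ℝ (Fin n) × ℝ => q.2 • q.1 := by fun_prop
  have hF : ContDiffAt ℝ ∞ F (x, c⁻¹) := by
    have : ContDiffAt ℝ ∞ f ((x, c⁻¹).2 • (x, c⁻¹).1) := by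
      simpa [hcx] using hf.contDiffAt hf.mem
    exact this.comp (x, c⁻¹) hsm.contDiffAt
  have hderiv : (fderiv ℝ F (x, c⁻¹) ∘L .inr ℝ (EuclideanSpace ℝ (Fin n)) ℝ) 1 ≠ 0 := by
    have hF' : HasFDerivAt F (fderiv ℝ F (x, c⁻¹)) (x, c⁻¹) :=
      (hF.differentiableAt (by simp)).hasFDerivAt
    have h1 : HasDerivAt (fun s : ℝ => F (x, s)) (fderiv ℝ F (x, c⁻¹) (0, 1)) c⁻¹ :=
      hF'.comp_hasDerivAt c⁻¹ ((hasDerivAt_const _ x).prodMk (hasDerivAt_id _))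
    have h2 : HasDerivAt (fun s : ℝ => F (x, s)) (fderiv ℝ f y x) c⁻¹ := by
      have hl : HasDerivAt (fun s : ℝ => s • x) x c⁻¹ := by
        simpa using (hasDerivAt_id c⁻¹).smul_const x
      have hfd : HasFDerivAt f (fderiv ℝ f y) (c⁻¹ • x) := by
        rw [hcx]
        exact (hf.differentiableAt hf.mem).hasFDerivAt
      exact hfd.comp_hasDerivAt c⁻¹ hl
    have hpos := hstar.normal_pos y hy U f hf
    rw [inner_gradient_right] at hpos
    have : fderiv ℝ F (x, c⁻¹) (0, 1) = c * fderiv ℝ f y y := by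
      rw [h1.unique h2, hxdef, map_smul, smul_eq_mul]
    simpa [this, hc.ne'] using hpos.ne'
  have hinv := ContinuousLinearMap.isInvertible_of_apply_one_ne_zero hderiv
  let ψ := hF.implicitFunction (by simp) hinv
  have hψ : ContDiffAt ℝ ∞ ψ x := hF.contDiffAt_implicitFunction (by simp) hinv
  have hψx : ψ x = c⁻¹ := hF.implicitFunction_apply_self (by simp) hinv
  have hψF : ∀ᶠ z in 𝓝 x, F (z, ψ z) = F (x, c⁻¹) :=
    hF.eventually_apply_implicitFunction (by simp) hinv
  have hpos : ∀ᶠ z in 𝓝 x, 0 < ψ z :=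
    hψ.continuousAt.eventually_const_lt (by rw [hψx]; positivity)
  have hU : ∀ᶠ z in 𝓝 x, ψ z • z ∈ U := by
    have : ContinuousAt (fun z => ψ z • z) x := hψ.continuousAt.smul continuousAt_id
    refine this.eventually_mem (hf.isOpen.mem_nhds ?_)
    rw [hψx, hcx]
    exact hf.mem
  refine (hψ.inv (by rw [hψx]; positivity)).congr_of_eventuallyEq ?_
  filter_upwards [hψF, hpos, hU] with z hz hz0 hzU
  have hzf : f (ψ z • z) = 0 := by
    have : F (x, c⁻¹) = 0 := by simp [F, hcx, hfy]
    exact hz.trans this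
  have hfr := hf.mem_frontier_of_eq_zero hD.isOpen hzU hzf
  have := frakB_smul_of_mem_frontier hD hstar hfr (inv_pos.mpr hz0)
  rwa [smul_smul, inv_mul_cancel₀ hz0.ne', one_smul] at this

theorem contDiffAt_radialExtension (hD : IsSmoothBoundedOpen D) (hstar : IsStarShaped D)
    {φ : EuclideanSpace ℝ (Fin n) → ℝ} (hφ : SmoothOnSubset φ (frontier D))
    {x : EuclideanSpace ℝ (Fin n)} (hx : x ≠ 0) : ContDiffAt ℝ ∞ (radialExtension D φ) x := by
  obtain ⟨c, hc, y, hy, rfl⟩ := exists_smul_mem_frontier hD hstar hx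
  obtain ⟨U, g, hU, hyU, hg, hgφ⟩ := hφ y hy
  have hproj : ContDiffAt ℝ ∞ (fun z => (frakB D z)⁻¹ • z) (c • y) :=
    ((contDiffAt_frakB hD hstar hx).inv (frakB_pos hD hstar hx).ne').smul contDiffAt_id
  have hval : (frakB D (c • y))⁻¹ • (c • y) = y := by
    rw [frakB_smul_of_mem_frontier hD hstar hy hc, smul_smul, inv_mul_cancel₀ hc.ne', one_smul]
  have hgat : ContDiffAt ℝ ∞ g ((frakB D (c • y))⁻¹ • (c • y)) := by
    rw [hval]
    exact hg.contDiffAt (hU.mem_nhds hyU)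
  have hcomp : ContDiffAt ℝ ∞ (fun z => g ((frakB D z)⁻¹ • z)) (c • y) :=
    ContDiffAt.comp (c • y) (f := fun z => (frakB D z)⁻¹ • z) hgat hproj
  refine hcomp.congr_of_eventuallyEq ?_
  have hnear : ∀ᶠ z in 𝓝 (c • y), (frakB D z)⁻¹ • z ∈ U :=
    hproj.continuousAt.eventually_mem (hU.mem_nhds (by rwa [hval]))
  filter_upwards [hnear, isOpen_ne.mem_nhds hx] with z hz hz0
  obtain ⟨s, hs, w, hw, rfl⟩ := exists_smul_mem_frontier hD hstar hz0
  rw [radialExtension_smul_of_mem_frontier hD hstar φ hw hs]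
  rw [frakB_smul_of_mem_frontier hD hstar hw hs, smul_smul, inv_mul_cancel₀ hs.ne', one_smul]
    at hz ⊢
  exact (hgφ ⟨hz, hw⟩).symm

end Radial

/-! ### Gradients and Hessians of homogeneous functions -/

section Derivatives

open Filter Topology InnerProductSpace

variable {n : ℕ} {u : EuclideanSpace ℝ (Fin n) → ℝ} {x : EuclideanSpace ℝ (Fin n)}

theorem _root_.ContDiffAt.gradient {m k : WithTop ℕ∞} (hu : ContDiffAt ℝ k u x) (hmk : m + 1 ≤ k) :
    ContDiffAt ℝ m (gradient u) x :=
  (toDual ℝ (EuclideanSpace ℝ (Fin n))).symm.contDiff.contDiffAt.comp x (hu.fderiv_right hmk)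

theorem inner_fderiv_gradient (u : EuclideanSpace ℝ (Fin n) → ℝ) (x v w : EuclideanSpace ℝ (Fin n)) :
    ⟪fderiv ℝ (gradient u) x v, w⟫ = fderiv ℝ (fderiv ℝ u) x v w := by
  have h : fderiv ℝ (gradient u) x = _ :=
    (toDual ℝ (EuclideanSpace ℝ (Fin n))).symm.comp_fderiv (f := fderiv ℝ u) (x := x)
  rw [h]
  exact toDual_symm_apply

theorem hessian_isSymmetric (hu : ContDiffAt ℝ 2 u x) : (hessian u x).IsSymmetric := by
  intro v w
  have h : IsSymmSndFDerivAt ℝ u x := hu.isSymmSndFDerivAt (by simp)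
  rw [real_inner_comm (hessian u x w) v]
  exact (inner_fderiv_gradient u x v w).trans
    ((h.eq v w).trans (inner_fderiv_gradient u x w v).symm)

theorem gradient_smul_of_homogeneous {m : ℕ}
    (hu : ∀ z : EuclideanSpace ℝ (Fin n), z ≠ 0 → ∀ c : ℝ, 0 < c → u (c • z) = c ^ m * u z)
    (hx : x ≠ 0) {c : ℝ} (hc : 0 < c) :
    c • gradient u (c • x) = c ^ m • gradient u x := by
  have h : (fun z => u (c • z)) =ᶠ[𝓝 x] c ^ m • u := by
    filter_upwards [isOpen_ne.mem_nhds hx] with z hz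
    simpa using hu z hz c hc
  have h1 := h.fderiv_eq (𝕜 := ℝ)
  rw [fderiv_comp_smul, fderiv_const_smul_field, Pi.smul_apply] at h1
  have h2 := congrArg (toDual ℝ (EuclideanSpace ℝ (Fin n))).symm h1
  rwa [map_smul, map_smul] at h2

theorem fderiv_gradient_smul_of_homogeneous {m : ℕ}
    (hu : ∀ z : EuclideanSpace ℝ (Fin n), z ≠ 0 → ∀ c : ℝ, 0 < c → u (c • z) = c ^ m * u z)
    (hx : x ≠ 0) {c : ℝ} (hc : 0 < c) :
    c ^ 2 • fderiv ℝ (gradient u) (c • x) = c ^ m • fderiv ℝ (gradient u) x := by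
  have h : (c • fun z => gradient u (c • z)) =ᶠ[𝓝 x] c ^ m • gradient u := by
    filter_upwards [isOpen_ne.mem_nhds hx] with z hz
    exact gradient_smul_of_homogeneous hu hz hc
  have h1 := h.fderiv_eq (𝕜 := ℝ)
  rwa [fderiv_const_smul_field, Pi.smul_apply, fderiv_comp_smul,
    fderiv_const_smul_field, Pi.smul_apply, smul_smul, ← sq] at h1

end Derivatives

/-! ### The derivatives of the subsolution -/

section Subsolution

open Filter Topology InnerProductSpace

variable {n : ℕ} {D : Set (EuclideanSpace ℝ (Fin n))} {φ : EuclideanSpace ℝ (Fin n) → ℝ}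
  {x : EuclideanSpace ℝ (Fin n)}

theorem gradient_frakB_smul (hD : IsSmoothBoundedOpen D) (hstar : IsStarShaped D) (hx : x ≠ 0)
    {c : ℝ} (hc : 0 < c) : gradient (frakB D) (c • x) = gradient (frakB D) x := by
  have h := gradient_smul_of_homogeneous (m := 1)
    (fun z hz c hc => by rw [pow_one]; exact frakB_smul hD hstar hz hc) hx hc
  rw [pow_one] at h
  exact smul_right_injective _ hc.ne' h

theorem fderiv_gradient_frakB_smul (hD : IsSmoothBoundedOpen D) (hstar : IsStarShaped D)
    (hx : x ≠ 0) {c : ℝ} (hc : 0 < c) :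
    fderiv ℝ (gradient (frakB D)) (c • x) = c⁻¹ • fderiv ℝ (gradient (frakB D)) x := by
  have h := fderiv_gradient_smul_of_homogeneous (m := 1)
    (fun z hz c hc => by rw [pow_one]; exact frakB_smul hD hstar hz hc) hx hc
  rw [eq_inv_smul_iff₀ hc.ne']
  refine smul_right_injective _ hc.ne' ?_
  simpa [smul_smul, sq] using h

theorem fderiv_gradient_radialExtension_smul (hD : IsSmoothBoundedOpen D) (hstar : IsStarShaped D)
    (φ : EuclideanSpace ℝ (Fin n) → ℝ) (hx : x ≠ 0) {c : ℝ} (hc : 0 < c) :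
    fderiv ℝ (gradient (radialExtension D φ)) (c • x) =
      (c ^ 2)⁻¹ • fderiv ℝ (gradient (radialExtension D φ)) x := by
  have h := fderiv_gradient_smul_of_homogeneous (m := 0)
    (fun z hz c hc => by rw [pow_zero, one_mul]; exact radialExtension_smul hD hstar φ hz hc) hx hc
  rw [pow_zero, one_smul] at h
  rw [eq_inv_smul_iff₀ (by positivity), h]

theorem gradient_frakB_ne_zero (hD : IsSmoothBoundedOpen D) (hstar : IsStarShaped D)
    (hx : x ≠ 0) : gradient (frakB D) x ≠ 0 := by
  intro h0
  have hd : HasFDerivAt (frakB D) (0 : EuclideanSpace ℝ (Fin n) →L[ℝ] ℝ) ((1 : ℝ) • x) := by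
    have h1 := ((contDiffAt_frakB hD hstar hx).differentiableAt (by simp)).hasFDerivAt
    rwa [← toDual_gradient, h0, map_zero, ← one_smul ℝ x] at h1
  have hl : HasDerivAt (fun t : ℝ => t • x) x 1 := by
    simpa using (hasDerivAt_id (1 : ℝ)).smul_const x
  have h1 := hd.comp_hasDerivAt 1 hl
  have h2 : HasDerivAt (fun t : ℝ => t * frakB D x) (frakB D x) 1 := by
    simpa using (hasDerivAt_id (1 : ℝ)).mul_const (frakB D x)
  have h3 := h2.congr_of_eventuallyEq (f₁ := frakB D ∘ fun t : ℝ => t • x) (by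
    filter_upwards [eventually_gt_nhds zero_lt_one] with t ht
    exact frakB_smul hD hstar hx ht)
  exact (frakB_pos hD hstar hx).ne (by simpa using h1.unique h3)

theorem gradient_frakB_sub_one : gradient (fun z => frakB D z - 1) = gradient (frakB D) := by
  funext z
  rw [gradient, gradient, fderiv_sub_const]

/-- Away from the origin `𝔟 - 1` defines `D`, so the curvature hypotheses can be read off from
the derivatives of `𝔟`. -/
theorem isLocalDefiningFunction_frakB_sub_one (hD : IsSmoothBoundedOpen D) (hstar : IsStarShaped D)
    (hx : x ≠ 0) : IsLocalDefiningFunction D x {0}ᶜ (fun z => frakB D z - 1) where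
  isOpen := isOpen_compl_singleton
  mem := hx
  smooth := fun _ hz => ((contDiffAt_frakB hD hstar hz).sub contDiffAt_const).contDiffWithinAt
  mem_iff := fun _ hz => by rw [mem_iff_frakB_lt_one hD hstar hz, sub_neg]
  gradient_ne_zero := fun _ hz _ => by
    rw [gradient_frakB_sub_one]
    exact gradient_frakB_ne_zero hD hstar hz

theorem contDiffAt_subsolution (hD : IsSmoothBoundedOpen D) (hstar : IsStarShaped D)
    (hφ : SmoothOnSubset φ (frontier D)) (N : ℝ) (hx : x ≠ 0) :
    ContDiffAt ℝ ∞ (subsolution D φ N) x :=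
  (((contDiffAt_frakB hD hstar hx).rpow_const_of_ne (frakB_pos hD hstar hx).ne').sub
    contDiffAt_const).add (contDiffAt_radialExtension hD hstar hφ hx)

theorem gradient_subsolution (hD : IsSmoothBoundedOpen D) (hstar : IsStarShaped D)
    (hφ : SmoothOnSubset φ (frontier D)) (N : ℝ) (hx : x ≠ 0) :
    gradient (subsolution D φ N) x =
      (N * frakB D x ^ (N - 1)) • gradient (frakB D) x + gradient (radialExtension D φ) x := by
  have hb := ((contDiffAt_frakB hD hstar hx).differentiableAt (by simp)).hasFDerivAt
  have hφ' := ((contDiffAt_radialExtension hD hstar hφ hx).differentiableAt (by simp)).hasFDerivAt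
  have h : HasFDerivAt (subsolution D φ N) _ x :=
    ((hb.rpow_const (p := N) (Or.inl (frakB_pos hD hstar hx).ne')).sub_const 1).add hφ'
  rw [gradient, h.fderiv, map_add, gradient, gradient]
  simp

theorem fderiv_gradient_subsolution (hD : IsSmoothBoundedOpen D) (hstar : IsStarShaped D)
    (hφ : SmoothOnSubset φ (frontier D)) (N : ℝ) (hx : x ≠ 0) :
    fderiv ℝ (gradient (subsolution D φ N)) x =
      (N * frakB D x ^ (N - 1)) • fderiv ℝ (gradient (frakB D)) x +
        (N * (N - 1) * frakB D x ^ (N - 2)) •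
          rankOne ℝ (gradient (frakB D) x) (gradient (frakB D) x) +
        fderiv ℝ (gradient (radialExtension D φ)) x := by
  have hb := ((contDiffAt_frakB hD hstar hx).differentiableAt (by simp)).hasFDerivAt
  have hgb : HasFDerivAt (gradient (frakB D)) _ x :=
    (((contDiffAt_frakB hD hstar hx).gradient (m := 1) (by norm_cast)).differentiableAt
      (by simp)).hasFDerivAt
  have hgφ : HasFDerivAt (gradient (radialExtension D φ)) _ x :=
    (((contDiffAt_radialExtension hD hstar hφ hx).gradient (m := 1)
      (by norm_cast)).differentiableAt (by simp)).hasFDerivAt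
  have hcoef := (hb.rpow_const (p := N - 1) (Or.inl (frakB_pos hD hstar hx).ne')).const_mul N
  have h := (hcoef.smul hgb).add hgφ
  have heq : gradient (subsolution D φ N) =ᶠ[𝓝 x] fun z =>
      (N * frakB D z ^ (N - 1)) • gradient (frakB D) z + gradient (radialExtension D φ) z := by
    filter_upwards [isOpen_ne.mem_nhds hx] with z hz
    exact gradient_subsolution hD hstar hφ N hz
  rw [heq.fderiv_eq]
  refine h.fderiv.trans ?_
  congr 2
  ext1 v
  have h2 : N - 1 - 1 = N - 2 := by ring
  simp [smul_smul, h2, inner_gradient_left, mul_assoc]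

/-- By homogeneity, the Hessian of the subsolution at the point `c • y`, `y ∈ ∂D`, is a positive
multiple of a rank-one perturbation of `D²𝔟(y) + ε D²φ(y)` with the large coefficient `N - 1` and
the small `ε = 1 / (N c ^ N)`. -/
theorem hessian_subsolution_smul (hD : IsSmoothBoundedOpen D) (hstar : IsStarShaped D)
    (hφ : SmoothOnSubset φ (frontier D)) {N : ℝ} (hN : 0 < N) {y : EuclideanSpace ℝ (Fin n)}
    (hy : y ∈ frontier D) {c : ℝ} (hc : 0 < c) :
    hessian (subsolution D φ N) (c • y) =
      (N * c ^ (N - 2)) •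
        ((fderiv ℝ (gradient (frakB D)) y +
            (N * c ^ N)⁻¹ • fderiv ℝ (gradient (radialExtension D φ)) y).toLinearMap +
          (N - 1) • (rankOne ℝ (gradient (frakB D) y) (gradient (frakB D) y)).toLinearMap) := by
  have hy0 := ne_zero_of_mem_frontier hD hstar hy
  have e1 : c ^ (N - 1) = c ^ (N - 2) * c := by
    rw [← Real.rpow_add_one hc.ne']
    congr 1
    ring
  have e2 : c ^ N = c ^ (N - 2) * c ^ 2 := by
    rw [← Real.rpow_natCast, ← Real.rpow_add hc]
    congr 1
    push_cast
    ring
  have hcp : 0 < c ^ (N - 2) := Real.rpow_pos_of_pos hc _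
  have h := fderiv_gradient_subsolution hD hstar hφ N (smul_ne_zero hc.ne' hy0)
  rw [frakB_smul_of_mem_frontier hD hstar hy hc, gradient_frakB_smul hD hstar hy0 hc,
    fderiv_gradient_frakB_smul hD hstar hy0 hc,
    fderiv_gradient_radialExtension_smul hD hstar φ hy0 hc] at h
  have h' : fderiv ℝ (gradient (subsolution D φ N)) (c • y) =
      (N * c ^ (N - 2)) •
        ((fderiv ℝ (gradient (frakB D)) y +
            (N * c ^ N)⁻¹ • fderiv ℝ (gradient (radialExtension D φ)) y) +
          (N - 1) • rankOne ℝ (gradient (frakB D) y) (gradient (frakB D) y)) := by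
    rw [h, e1, e2]
    match_scalars <;> field_simp
  rw [hessian, h']
  rfl

end Subsolution

/-! ### Large rank-one perturbations over a compact set -/

section Estimate

open Filter Topology InnerProductSpace Module

/-- If all the compressions `H(y)|_{p(y)ᗮ}` over a compact set have positive `i`-th elementary
symmetric function, then the `(i + 1)`-st one of `H + ε Φ + t p ⊗ p` exceeds `1` on the whole set
once `t` is large and `ε` is small. Positivity of the slope in `t` is used only at `ε = 0`; nearby
it persists because the slope is a difference of two values of the continuous function
`charSigma (i + 1)`, so that the varying subspaces `p(y)ᗮ` need not be compared. -/
theorem eventually_forall_one_lt_charSigma {V X : Type*} [NormedAddCommGroup V]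
    [InnerProductSpace ℝ V] [FiniteDimensional ℝ V] [TopologicalSpace X] {K : Set X}
    (hK : IsCompact K) {H Φ : X → V →L[ℝ] V} {p : X → V} (hH : ∀ y ∈ K, ContinuousAt H y)
    (hΦ : ∀ y ∈ K, ContinuousAt Φ y) (hp : ∀ y ∈ K, ContinuousAt p y)
    (hp0 : ∀ y ∈ K, p y ≠ 0) {i : ℕ} (hi : i + 1 ≤ finrank ℝ V)
    (hpos : ∀ y ∈ K, 0 < charSigma i (compression (p y) (H y).toLinearMap)) :
    ∀ᶠ q : ℝ × ℝ in atTop ×ˢ 𝓝 0, ∀ y ∈ K,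
      1 < charSigma (i + 1)
        ((H y + q.2 • Φ y).toLinearMap + q.1 • (rankOne ℝ (p y) (p y)).toLinearMap) := by
  have hlocal : ∀ y₀ ∈ K, ∀ᶠ z : (ℝ × ℝ) × X in (atTop ×ˢ 𝓝 0) ×ˢ 𝓝 y₀,
      p z.2 ≠ 0 → 1 < charSigma (i + 1) ((H z.2 + z.1.2 • Φ z.2).toLinearMap +
        z.1.1 • (rankOne ℝ (p z.2) (p z.2)).toLinearMap) := by
    intro y₀ hy₀
    -- The value at slope `t` is `a + t * (a' - a)`, where `a` and `a'` are the values at `0`, `1`.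
    let a : ℝ × X → ℝ := fun w => charSigma (i + 1) (H w.2 + w.1 • Φ w.2).toLinearMap
    let a' : ℝ × X → ℝ := fun w => charSigma (i + 1)
      (H w.2 + w.1 • Φ w.2 + rankOne ℝ (p w.2) (p w.2)).toLinearMap
    have hH' : ContinuousAt (fun w : ℝ × X => H w.2) (0, y₀) :=
      ContinuousAt.comp (f := Prod.snd) (x := ((0 : ℝ), y₀)) (hH y₀ hy₀) continuousAt_snd
    have hΦ' : ContinuousAt (fun w : ℝ × X => Φ w.2) (0, y₀) :=
      ContinuousAt.comp (f := Prod.snd) (x := ((0 : ℝ), y₀)) (hΦ y₀ hy₀) continuousAt_snd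
    have hp' : ContinuousAt (fun w : ℝ × X => p w.2) (0, y₀) :=
      ContinuousAt.comp (f := Prod.snd) (x := ((0 : ℝ), y₀)) (hp y₀ hy₀) continuousAt_snd
    have hr' : ContinuousAt (fun w : ℝ × X => rankOne ℝ (p w.2) (p w.2)) (0, y₀) :=
      ((rankOne ℝ (E := V) (F := V)).continuous.continuousAt.comp hp').clm_apply hp'
    have hB : ContinuousAt (fun w : ℝ × X => H w.2 + w.1 • Φ w.2) (0, y₀) :=
      hH'.add (continuousAt_fst.smul hΦ')
    have ha : ContinuousAt a (0, y₀) :=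
      ContinuousAt.comp (g := fun T : V →L[ℝ] V => charSigma (i + 1) T.toLinearMap)
        (continuous_charSigma (i + 1)).continuousAt hB
    have ha' : ContinuousAt a' (0, y₀) :=
      ContinuousAt.comp (g := fun T : V →L[ℝ] V => charSigma (i + 1) T.toLinearMap)
        (continuous_charSigma (i + 1)).continuousAt (hB.add hr')
    have haffine : ∀ (w : ℝ × X) (t : ℝ), p w.2 ≠ 0 → charSigma (i + 1)
        ((H w.2 + w.1 • Φ w.2).toLinearMap + t • (rankOne ℝ (p w.2) (p w.2)).toLinearMap) =
        a w + t * (a' w - a w) := by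
      intro w t hw
      have h1 := charSigma_add_rankOne hw hi (H w.2 + w.1 • Φ w.2).toLinearMap 1
      have h2 : a' w = charSigma (i + 1) ((H w.2 + w.1 • Φ w.2).toLinearMap +
          (1 : ℝ) • (rankOne ℝ (p w.2) (p w.2)).toLinearMap) := by
        rw [one_smul]
        rfl
      rw [charSigma_add_rankOne hw hi, h2, h1]
      ring
    have hslope : 0 < a' (0, y₀) - a (0, y₀) := by
      have h0 := haffine (0, y₀) 1 (hp0 y₀ hy₀)
      rw [charSigma_add_rankOne (hp0 y₀ hy₀) hi] at h0
      simp only [zero_smul, add_zero, one_mul] at h0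
      have h1 : a (0, y₀) = charSigma (i + 1) (H y₀).toLinearMap := by simp [a]
      have h2 : 0 < ‖p y₀‖ ^ 2 * charSigma i (compression (p y₀) (H y₀).toLinearMap) :=
        mul_pos (pow_pos (norm_pos_iff.mpr (hp0 y₀ hy₀)) 2) (hpos y₀ hy₀)
      linarith
    have hw : Tendsto (fun z : (ℝ × ℝ) × X => (z.1.2, z.2)) ((atTop ×ˢ 𝓝 0) ×ˢ 𝓝 y₀)
        (𝓝 (0, y₀)) := by
      rw [nhds_prod_eq]
      exact (tendsto_snd.comp tendsto_fst).prodMk tendsto_snd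
    have ht : Tendsto (fun z : (ℝ × ℝ) × X => z.1.1) ((atTop ×ˢ 𝓝 (0 : ℝ)) ×ˢ 𝓝 y₀) atTop :=
      tendsto_fst.comp tendsto_fst
    have hlim := (ha.tendsto.comp hw).add_atTop
      (ht.atTop_mul_pos hslope ((ha'.tendsto.sub ha.tendsto).comp hw))
    filter_upwards [hlim.eventually_gt_atTop 1] with z hz hpz
    rw [haffine (z.1.2, z.2) z.1.1 hpz]
    exact hz
  have h : ∀ᶠ z : (ℝ × ℝ) × X in (atTop ×ˢ 𝓝 0) ×ˢ 𝓝ˢ K, _ :=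
    hK.mem_prod_nhdsSet_of_forall hlocal
  filter_upwards [h.curry] with q hq y hy
  exact hq.self_of_nhdsSet y hy (hp0 y hy)

end Estimate

/-! ### Strict convexity of the boundary and the choice of the exponent -/

section Boundary

open InnerProductSpace Module

variable {n : ℕ} {D : Set (EuclideanSpace ℝ (Fin n))}

/-- Up to the factor `|∇𝔟|`, the compression of `D²𝔟` to the tangent space is the shape operator. -/
theorem charSigma_compression_hessian_frakB_pos (hD : IsSmoothBoundedOpen D)
    (hstar : IsStarShaped D) {m : ℕ} (hmn : m + 1 ≤ n) (hconv : IsStrictlyConvexDomain m D)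
    {y : EuclideanSpace ℝ (Fin n)} (hy : y ∈ frontier D) {i : ℕ} (hi : i ≤ m) :
    0 < charSigma i (compression (gradient (frakB D) y)
      (fderiv ℝ (gradient (frakB D)) y).toLinearMap) := by
  rcases Nat.eq_zero_or_pos i with rfl | hi0
  · rw [charSigma_zero]
    exact one_pos
  have hy0 := ne_zero_of_mem_frontier hD hstar hy
  have hf := isLocalDefiningFunction_frakB_sub_one hD hstar hy0
  have hpos := hconv y hy _ _ hf i hi0 hi
  have hp := gradient_frakB_ne_zero hD hstar hy0
  set f : EuclideanSpace ℝ (Fin n) → ℝ := fun z => frakB D z - 1 with hfdef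
  rw [← gradient_frakB_sub_one (D := D), ← hfdef] at hp ⊢
  have hdim : i ≤ finrank ℝ (ℝ ∙ gradient f y)ᗮ := by
    have := finrank_orthogonal_singleton_add_one hp
    rw [finrank_euclideanSpace_fin] at this
    omega
  have hsymm : (compression (gradient f y) (hessian f y)).IsSymmetric :=
    compression_isSymmetric _ (hessian_isSymmetric ((hf.contDiffAt hf.mem).of_le (by norm_cast)))
  have hshape : shapeOperator f y =
      ‖gradient f y‖⁻¹ • compression (gradient f y) (hessian f y) := rfl
  rw [hshape, sigma_eq_charSigma hdim (hsymm.smul (by simp)), charSigma_smul hdim] at hpos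
  have hnorm : 0 < ‖gradient f y‖ := norm_pos_iff.mpr hp
  exact pos_of_mul_pos_right hpos (by positivity)

end Boundary

end ExteriorHessian

open ExteriorHessian Filter Topology Module in
theorem proposition2p1 (n k : ℕ) (hn : 3 ≤ n) (hk : 2 ≤ k) (hkn : k ≤ n - 1)
    (D : Set (EuclideanSpace ℝ (Fin n)))
    (hD : ExteriorHessian.IsSmoothBoundedOpen D)
    (hstar : ExteriorHessian.IsStarShaped D)
    (hconv : ExteriorHessian.IsStrictlyConvexDomain (k - 1) D)
    (φ : EuclideanSpace ℝ (Fin n) → ℝ)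
    (hφ : ExteriorHessian.SmoothOnSubset φ (frontier D))
    (A : Matrix (Fin n) (Fin n) ℝ) (hA : A ∈ ExteriorHessian.classA n k) :
    ∃ N₁ : ℝ, 0 < N₁ ∧ ∀ N : ℝ, N₁ ≤ N →
      ExteriorHessian.StrictlyKConvexOn k (ExteriorHessian.subsolution D φ N)
        (ExteriorHessian.ellipsoid A 1 \ closure D) ∧
      (∀ x ∈ ExteriorHessian.ellipsoid A 1 \ closure D,
        1 < ExteriorHessian.sigma k
          (ExteriorHessian.hessian (ExteriorHessian.subsolution D φ N) x)) ∧
      ∀ x ∈ frontier D, ExteriorHessian.subsolution D φ N x = φ x := by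
  have hK : IsCompact (frontier D) :=
    Metric.isCompact_of_isClosed_isBounded isClosed_frontier
      (hD.isBounded.closure.subset frontier_subset_closure)
  have hne : ∀ y ∈ frontier D, y ≠ 0 := fun y hy => ne_zero_of_mem_frontier hD hstar hy
  have hsmooth : ∀ (u : EuclideanSpace ℝ (Fin n) → ℝ) (y : EuclideanSpace ℝ (Fin n)),
      ContDiffAt ℝ ∞ u y →
        ContinuousAt (gradient u) y ∧ ContinuousAt (fun z => fderiv ℝ (gradient u) z) y :=
    fun u y hu => by
      have h1 : ContDiffAt ℝ 1 (gradient u) y := hu.gradient (by norm_cast)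
      exact ⟨h1.continuousAt, (h1.fderiv_right (m := 0) (by simp)).continuousAt⟩
  have hev : ∀ᶠ q : ℝ × ℝ in atTop ×ˢ 𝓝 0, ∀ i ∈ Finset.range k, ∀ y ∈ frontier D,
      1 < charSigma (i + 1)
        ((fderiv ℝ (gradient (frakB D)) y +
            q.2 • fderiv ℝ (gradient (radialExtension D φ)) y).toLinearMap +
          q.1 • (InnerProductSpace.rankOne ℝ (gradient (frakB D) y)
            (gradient (frakB D) y)).toLinearMap) :=
    (eventually_all_finset (Finset.range k)).mpr fun i hi =>
      eventually_forall_one_lt_charSigma hK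
        (fun y hy => (hsmooth _ y (contDiffAt_frakB hD hstar (hne y hy))).2)
        (fun y hy => (hsmooth _ y (contDiffAt_radialExtension hD hstar hφ (hne y hy))).2)
        (fun y hy => (hsmooth _ y (contDiffAt_frakB hD hstar (hne y hy))).1)
        (fun y hy => gradient_frakB_ne_zero hD hstar (hne y hy))
        (by rw [finrank_euclideanSpace_fin]; have := Finset.mem_range.mp hi; omega)
        (fun y hy => charSigma_compression_hessian_frakB_pos hD hstar (m := k - 1) (by omega)
          hconv hy (by have := Finset.mem_range.mp hi; omega))
  obtain ⟨P, hP, Q, hQ, hPQ⟩ := eventually_prod_iff.mp hev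
  obtain ⟨T, hT⟩ := eventually_atTop.mp hP
  obtain ⟨δ, hδ, hδQ⟩ := Metric.eventually_nhds_iff.mp hQ
  -- `N ≥ 2` bounds the prefactor `N c ^ (N - 2)` from below, `N ≥ T + 1` makes the rank-one
  -- coefficient large, and `N ≥ 2 / δ` makes `1 / (N c ^ N)` small; here `c ≥ 1`.
  have hmain : ∀ N : ℝ, 2 ≤ N → T + 1 ≤ N → 2 / δ ≤ N → ∀ x ∉ closure D,
      ∀ j : ℕ, 1 ≤ j → j ≤ k → 1 < sigma j (hessian (subsolution D φ N) x) := by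
    intro N hN2 hNT hNδ x hx j hj hjk
    have hxD : x ∉ D := fun h => hx (subset_closure h)
    have hx0 : x ≠ 0 := by
      rintro rfl
      exact hxD hstar.zero_mem
    have hsymm := hessian_isSymmetric
      ((contDiffAt_subsolution hD hstar hφ N hx0).of_le (m := 2) (by norm_cast))
    have hjn : j ≤ finrank ℝ (EuclideanSpace ℝ (Fin n)) := by
      rw [finrank_euclideanSpace_fin]
      omega
    rw [sigma_eq_charSigma hjn hsymm]
    obtain ⟨c, hc, y, hy, rfl⟩ := exists_smul_mem_frontier hD hstar hx0
    have hc1 : 1 ≤ c := by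
      by_contra! h
      exact hxD ((smul_mem_iff_of_mem_frontier hD hstar hy hc.le).mpr h)
    have hN0 : 0 < N := by linarith
    rw [hessian_subsolution_smul hD hstar hφ hN0 hy hc, charSigma_smul hjn]
    have hfac : 1 ≤ N * c ^ (N - 2) := by
      have := Real.one_le_rpow hc1 (show 0 ≤ N - 2 by linarith)
      nlinarith
    have hsmall : dist (N * c ^ N)⁻¹ 0 < δ := by
      have h1 : 1 ≤ c ^ N := Real.one_le_rpow hc1 hN0.le
      have h2 : N ≤ N * c ^ N := le_mul_of_one_le_right hN0.le h1
      rw [Real.dist_0_eq_abs, abs_of_pos (by positivity)]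
      refine inv_lt_of_inv_lt₀ hδ (lt_of_lt_of_le ?_ (hNδ.trans h2))
      rw [inv_eq_one_div]
      exact div_lt_div_of_pos_right one_lt_two hδ
    have h1 := hPQ (hT (N - 1) (by linarith)) (hδQ hsmall) (j - 1)
      (Finset.mem_range.mpr (by omega)) y hy
    rw [Nat.sub_add_cancel hj] at h1
    exact one_lt_mul_of_le_of_lt (one_le_pow₀ hfac) h1
  refine ⟨max 2 (max (T + 1) (2 / δ)), by positivity, fun N hN => ?_⟩
  obtain ⟨hN2, hNT, hNδ⟩ : 2 ≤ N ∧ T + 1 ≤ N ∧ 2 / δ ≤ N := by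
    simpa [max_le_iff] using hN
  refine ⟨⟨fun x hx => ?_, fun x hx j hj hjk =>
    one_pos.trans (hmain N hN2 hNT hNδ x hx.2 j hj hjk)⟩,
    fun x hx => hmain N hN2 hNT hNδ x hx.2 k (by omega) le_rfl, fun x hx => ?_⟩
  · have hx0 : x ≠ 0 := by
      rintro rfl
      exact hx.2 (subset_closure hstar.zero_mem)
    exact ((contDiffAt_subsolution hD hstar hφ N hx0).of_le (by norm_cast)).contDiffWithinAt
  · have h1 := frakB_smul_of_mem_frontier hD hstar hx one_pos
    have h2 := radialExtension_smul_of_mem_frontier hD hstar φ hx one_pos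
    rw [one_smul] at h1 h2
    rw [subsolution, h1, h2, Real.one_rpow, sub_self, zero_add]
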